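/- Let $SU(1,1)$ be the group of matrices $g=\begin{pmatrix} a & b\\ \bar b & \bar a\end{pmatrix}$ with $|a|^2-|b|^2=1$, acting on $\mathbb C$ by $g\cdot\tilde\alpha=a\alpha+b\bar\alpha$, and let $G^J_1=H_1\rtimes SU(1,1)$ be the Jacobi group, i.e. the set of triples $(g,\alpha,t)\in SU(1,1)\times\mathbb C\times\mathbb R$ with $$(g_1,\alpha_1,t_1)(g_2,\alpha_2,t_2)=\bigl(g_1g_2,\ g_2^{-1}\cdot\tilde\alpha_1+\alpha_2,\ t_1+t_2+\operatorname{Im}((g_2^{-1}\cdot\tilde\alpha_1)\,\bar\alpha_2)\bigr).$$ Let $\pi$ be a strongly continuous unitary representation of $G^J_1$ on a complex Hilbert space $\mathcal H$ with $\pi(1,0,t)=e^{it}$. Write $S(g)=\pi(g,0,0)$ and let $a,a^+,K_0,K_\pm$ be the operators on the smooth vectors obtained by complex-linear extension of the derived representation, where $\alpha a^+-\bar\alpha a$ generates $s\mapsto\pi(1,s\alpha,0)$ and, for $\theta\in\mathbb R$, $y\in\mathbb C$, the operator $2i\theta K_0+yK_+-\bar yK_-$ generates $s\mapsto S\bigl(\exp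 s\begin{pmatrix} i\theta & y\\ \bar y & -i\theta\end{pmatrix}\bigr)$. Put $D(\alpha)=\exp(\alpha a^+-\bar\alpha a)=\pi(1,\alpha,0)$. Let $k$ satisfy $2k\in\{2,3,\dots\}$ and let $e_0\in\mathcal H$ be a smooth vector with $ae_0=0$, $K_-e_0=0$, $K_0e_0=ke_0$. Then for all $z\in\mathbb C$ and $|w|<1$ the series $$e_{z,w}=\exp(za^++wK_+)e_0=\sum_{n\ge0}\frac{1}{n!}(za^++wK_+)^ne_0$$ converges in $\mathcal H$, and for all $g=\begin{pmatrix} a & b\\ \bar b & \bar a\end{pmatrix}\in SU(1,1)$, $\alpha,z\in\mathbb C$, $|w|<1$, $$S(g)D(\alpha)e_{z,w}=\lambda\, e_{z_1,w_1},\qquad z_1=\frac{\alpha-\bar\alpha w+z}{\bar b w+\bar a},\qquad w_1=\frac{aw+b}{\bar b w+\bar a},$$ where $\bar bw+\bar a\neq0$, $|w_1|<1$, and $$\lambda=\lambda(g,\alpha;z,w)=(\bar a+\bar bw)^{-2k}\exp\Bigl(\frac z2\bar\alpha_0-\frac{z_1}2\bar\alpha_2\Bigr)e^{i\theta_h(\alpha,\alpha_0)},$$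 $$\alpha_0=\frac{z+\bar zw}{1-|w|^2},\qquad \alpha_2=(\alpha+\alpha_0)a+(\bar\alpha+\bar\alpha_0)b,\qquad \theta_h(\alpha,\beta)=\operatorname{Im}(\alpha\bar\beta).$$ Moreover, with $\mathcal D_1=\{|w|<1\}$, the formula $(g,\alpha,t)\cdot(z,w)=(z_1,w_1)$ defines a left action of $G^J_1$ on $\mathbb C\times\mathcal D_1$ by holomorphic maps, and $J((g,\alpha,t),(z,w))=e^{it}\lambda(g,\alpha;z,w)$ is a nowhere vanishing multiplier of this action, holomorphic in $(z,w)$: $J(h_1h_2,x)=J(h_1,h_2\cdot x)\,J(h_2,x)$. -/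

import Mathlib

open scoped ComplexConjugate ContDiff

/-- The group `SU(1,1)` of matrices `(a b; b̄ ā)` with `|a|² - |b|² = 1`, as a subgroup of
`SL(2, ℂ)`. -/
def SU11Subgroup : Subgroup (Matrix.SpecialLinearGroup (Fin 2) ℂ) where
  carrier := {g | g 1 0 = conj (g 0 1) ∧ g 1 1 = conj (g 0 0)}
  one_mem' := by simp
  mul_mem' := by
    rintro g h ⟨hg1, hg2⟩ ⟨hh1, hh2⟩
    constructor <;>
      simp [Matrix.mul_apply, Fin.sum_univ_two, hg1, hg2, hh1, hh2] <;> ring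
  inv_mem' := by
    rintro g ⟨hg1, hg2⟩
    constructor <;> simp [Matrix.SpecialLinearGroup.coe_inv, Matrix.adjugate_fin_two, hg1, hg2]

/-- The group `SU(1,1)`. -/
def SU11 : Type := SU11Subgroup

instance : Group SU11 := inferInstanceAs (Group SU11Subgroup)

namespace SU11

/-- The entry `a` of `g = (a b; b̄ ā)`. -/
def a (g : SU11) : ℂ := (g.1 : Matrix.SpecialLinearGroup (Fin 2) ℂ) 0 0

/-- The entry `b` of `g = (a b; b̄ ā)`. -/
def b (g : SU11) : ℂ := (g.1 : Matrix.SpecialLinearGroup (Fin 2) ℂ) 0 1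

/-- The element `(a b; b̄ ā)` of `SU(1,1)`. -/
def mk (a b : ℂ) (h : a * conj a - b * conj b = 1) : SU11 :=
  ⟨⟨!![a, b; conj b, conj a], by simpa [Matrix.det_fin_two] using h⟩, by simp, by simp⟩

theorem a_mul_conj_sub (g : SU11) : g.a * conj g.a - g.b * conj g.b = 1 := by
  have h := g.1.det_coe
  rw [Matrix.det_fin_two, g.2.1, g.2.2] at h
  exact h

@[simp] theorem a_one : (1 : SU11).a = 1 := rfl

@[simp] theorem b_one : (1 : SU11).b = 0 := rfl

@[simp] theorem a_mul (g h : SU11) : (g * h).a = g.a * h.a + g.b * conj h.b := by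
  have h0 : (g * h).a = g.1 0 0 * h.1 0 0 + g.1 0 1 * h.1 1 0 := by
    change (g.1 * h.1 : Matrix.SpecialLinearGroup (Fin 2) ℂ) 0 0 = _
    simp [Matrix.mul_apply, Fin.sum_univ_two]
  rw [h0, h.2.1]
  rfl

@[simp] theorem b_mul (g h : SU11) : (g * h).b = g.a * h.b + g.b * conj h.a := by
  have h0 : (g * h).b = g.1 0 0 * h.1 0 1 + g.1 0 1 * h.1 1 1 := by
    change (g.1 * h.1 : Matrix.SpecialLinearGroup (Fin 2) ℂ) 0 1 = _
    simp [Matrix.mul_apply, Fin.sum_univ_two]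
  rw [h0, h.2.2]
  rfl

@[simp] theorem a_inv (g : SU11) : (g⁻¹).a = conj g.a := by
  have h0 : (g⁻¹).a = g.1 1 1 := by
    change ((g.1)⁻¹ : Matrix.SpecialLinearGroup (Fin 2) ℂ) 0 0 = _
    simp [Matrix.SpecialLinearGroup.coe_inv, Matrix.adjugate_fin_two]
  rw [h0, g.2.2]
  rfl

@[simp] theorem b_inv (g : SU11) : (g⁻¹).b = -g.b := by
  change ((g.1)⁻¹ : Matrix.SpecialLinearGroup (Fin 2) ℂ) 0 1 = _
  simp [Matrix.SpecialLinearGroup.coe_inv, Matrix.adjugate_fin_two, b]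

@[simp] theorem a_mk (a b : ℂ) (h : a * conj a - b * conj b = 1) : (mk a b h).a = a := rfl

@[simp] theorem b_mk (a b : ℂ) (h : a * conj a - b * conj b = 1) : (mk a b h).b = b := rfl

/-- An element of `SU(1,1)` is determined by its entries `a` and `b`. -/
theorem ext_ab {g h : SU11} (ha : g.a = h.a) (hb : g.b = h.b) : g = h := by
  apply Subtype.ext
  ext i j
  fin_cases i <;> fin_cases j
  · exact ha
  · exact hb
  · exact g.2.1.trans ((congrArg conj hb).trans h.2.1.symm)
  · exact g.2.2.trans ((congrArg conj ha).trans h.2.2.symm)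

/-- The natural action of `SU(1,1)` on the plane, `α ↦ a α + b ᾱ`. -/
def planeAct (g : SU11) (α : ℂ) : ℂ := g.a * α + g.b * conj α

theorem planeAct_mul (g h : SU11) (α : ℂ) :
    (g * h).planeAct α = g.planeAct (h.planeAct α) := by
  simp [planeAct]; ring

theorem planeAct_add (g : SU11) (α β : ℂ) :
    g.planeAct (α + β) = g.planeAct α + g.planeAct β := by
  simp [planeAct]; ring

theorem planeAct_one (α : ℂ) : (1 : SU11).planeAct α = α := by simp [planeAct]

theorem planeAct_zero (g : SU11) : g.planeAct 0 = 0 := by simp [planeAct]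

theorem planeAct_inv_self (g : SU11) (α : ℂ) : (g⁻¹).planeAct (g.planeAct α) = α := by
  rw [← planeAct_mul, inv_mul_cancel, planeAct_one]

/-- The plane action preserves the symplectic form `Im (α β̄)`. -/
theorem im_planeAct (g : SU11) (α β : ℂ) :
    (g.planeAct α * conj (g.planeAct β)).im = (α * conj β).im := by
  have h := congrArg Complex.re g.a_mul_conj_sub
  simp only [planeAct, map_add, map_mul, Complex.conj_conj, Complex.mul_im, Complex.mul_re,
    Complex.add_re, Complex.add_im, Complex.conj_re, Complex.conj_im, Complex.sub_re,
    Complex.one_re] at h ⊢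
  linear_combination (α.im * β.re - α.re * β.im) * h

/-- The one-parameter subgroup `s ↦ diag (e^{is}, e^{-is})`, generated by `(i 0; 0 -i)`. -/
noncomputable def rot (s : ℝ) : SU11 :=
  mk (Complex.exp (s * Complex.I)) 0 (by
    rw [← Complex.exp_conj, ← Complex.exp_add]; simp)

/-- For `|u| = 1`, the one-parameter subgroup `s ↦ (cosh s, u sinh s; ū sinh s, cosh s)`,
generated by `(0 u; ū 0)`. -/
noncomputable def boost (u : ℂ) (hu : u * conj u = 1) (s : ℝ) : SU11 :=
  mk (Real.cosh s) (u * Real.sinh s) (by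
    have h : ((Real.cosh s : ℂ)) ^ 2 - (Real.sinh s : ℂ) ^ 2 = 1 := by
      exact_mod_cast Real.cosh_sq_sub_sinh_sq s
    simp only [map_mul, Complex.conj_ofReal]
    linear_combination h - (Real.sinh s : ℂ) ^ 2 * hu)

end SU11

/-- The Jacobi group `H₁ ⋊ SU(1,1)`. The triple `(g, α, t)` stands for the product of
`g ∈ SU(1,1)` with the element `(α, t)` of the Heisenberg-Weyl group `H₁`, in this order. -/
@[ext]
structure JacobiGroup where
  g : SU11
  α : ℂ
  t : ℝ

namespace JacobiGroup

instance : One JacobiGroup := ⟨⟨1, 0, 0⟩⟩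

instance : Mul JacobiGroup :=
  ⟨fun h₁ h₂ => ⟨h₁.g * h₂.g, (h₂.g⁻¹).planeAct h₁.α + h₂.α,
    h₁.t + h₂.t + ((h₂.g⁻¹).planeAct h₁.α * conj h₂.α).im⟩⟩

instance : Inv JacobiGroup := ⟨fun h => ⟨h.g⁻¹, -h.g.planeAct h.α, -h.t⟩⟩

@[simp] theorem one_g : (1 : JacobiGroup).g = 1 := rfl
@[simp] theorem one_α : (1 : JacobiGroup).α = 0 := rfl
@[simp] theorem one_t : (1 : JacobiGroup).t = 0 := rfl
@[simp] theorem mul_g (h₁ h₂ : JacobiGroup) : (h₁ * h₂).g = h₁.g * h₂.g := rfl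
@[simp] theorem mul_α (h₁ h₂ : JacobiGroup) :
    (h₁ * h₂).α = (h₂.g⁻¹).planeAct h₁.α + h₂.α := rfl
@[simp] theorem mul_t (h₁ h₂ : JacobiGroup) :
    (h₁ * h₂).t = h₁.t + h₂.t + ((h₂.g⁻¹).planeAct h₁.α * conj h₂.α).im := rfl
@[simp] theorem inv_g (h : JacobiGroup) : (h⁻¹).g = h.g⁻¹ := rfl
@[simp] theorem inv_α (h : JacobiGroup) : (h⁻¹).α = -h.g.planeAct h.α := rfl
@[simp] theorem inv_t (h : JacobiGroup) : (h⁻¹).t = -h.t := rfl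

instance : Group JacobiGroup :=
  Group.ofLeftAxioms
    (by
      intro x y z
      have key := SU11.im_planeAct z.g⁻¹ ((y.g⁻¹).planeAct x.α) y.α
      ext1
      · simp [mul_assoc]
      · simp [SU11.planeAct_add, SU11.planeAct_mul, add_assoc]
      · simp only [mul_t, mul_α, mul_g, mul_inv_rev, SU11.planeAct_add, SU11.planeAct_mul,
          map_add, mul_add, add_mul, Complex.add_im]
        linarith)
    (by
      intro x
      ext1
      · simp
      · simp [SU11.planeAct_zero]
      · simp [SU11.planeAct_zero])
    (by
      intro x
      have hneg : (x.g⁻¹).planeAct (-x.g.planeAct x.α) = -x.α := by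
        have h0 := SU11.planeAct_add x.g⁻¹ (-x.g.planeAct x.α) (x.g.planeAct x.α)
        rw [neg_add_cancel, SU11.planeAct_zero, SU11.planeAct_inv_self] at h0
        exact eq_neg_of_add_eq_zero_left h0.symm
      ext1
      · simp
      · simp [hneg]
      · simp only [mul_t, inv_t, inv_α, one_t, hneg, neg_mul, Complex.neg_im, Complex.mul_im,
          Complex.conj_re, Complex.conj_im]
        ring)

/-- The global coordinates `(a, b, α, t)`, which embed the Jacobi group as a closed
submanifold of `ℂ × ℂ × ℂ × ℝ`. -/
def coords (h : JacobiGroup) : ℂ × ℂ × ℂ × ℝ := (h.g.a, h.g.b, h.α, h.t)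

noncomputable instance : TopologicalSpace JacobiGroup := .induced coords inferInstance

/-- The one-parameter subgroup of the Heisenberg-Weyl group generated by `α a⁺ - ᾱ a`. -/
def heisenberg (α : ℂ) (s : ℝ) : JacobiGroup := ⟨1, s * α, 0⟩

/-- The one-parameter subgroup generated by `2 i K₀`. -/
noncomputable def rotation (s : ℝ) : JacobiGroup := ⟨SU11.rot s, 0, 0⟩

/-- For `|u| = 1`, the one-parameter subgroup generated by `u K₊ - ū K₋`. -/
noncomputable def boost (u : ℂ) (hu : u * conj u = 1) (s : ℝ) : JacobiGroup :=
  ⟨SU11.boost u hu s, 0, 0⟩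

end JacobiGroup

namespace JacobiRep

variable {H : Type*} [NormedAddCommGroup H] [InnerProductSpace ℂ H]

/-- A smooth vector of `π`: the orbit map `h ↦ π(h) v` is smooth on the Jacobi group, that is,
in the coordinates `(a, b, α, t)` it extends to a smooth map on an open neighbourhood. -/
def IsSmoothVector (π : JacobiGroup →* (H ≃ₗᵢ[ℂ] H)) (v : H) : Prop :=
  ∃ (U : Set (ℂ × ℂ × ℂ × ℝ)) (F : ℂ × ℂ × ℂ × ℝ → H),
    IsOpen U ∧ Set.range JacobiGroup.coords ⊆ U ∧ ContDiffOn ℝ ∞ F U ∧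
      ∀ h : JacobiGroup, F h.coords = π h v

/-- The derived representation: `dπ(X) v = d/ds π(exp sX) v` at `s = 0`, where
`γ s = exp sX` is the one-parameter subgroup generated by `X`. -/
noncomputable def derived (π : JacobiGroup →* (H ≃ₗᵢ[ℂ] H)) (γ : ℝ → JacobiGroup) (v : H) : H :=
  deriv (fun s : ℝ => π (γ s) v) 0

/-- The creation operator `a⁺ = (dπ(a⁺ - a) - i dπ(i a⁺ + i a)) / 2`. -/
noncomputable def create (π : JacobiGroup →* (H ≃ₗᵢ[ℂ] H)) (v : H) : H :=
  (1 / 2 : ℂ) • (derived π (JacobiGroup.heisenberg 1) v -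
    Complex.I • derived π (JacobiGroup.heisenberg Complex.I) v)

/-- The annihilation operator `a = -(dπ(a⁺ - a) + i dπ(i a⁺ + i a)) / 2`. -/
noncomputable def annihilate (π : JacobiGroup →* (H ≃ₗᵢ[ℂ] H)) (v : H) : H :=
  (-1 / 2 : ℂ) • (derived π (JacobiGroup.heisenberg 1) v +
    Complex.I • derived π (JacobiGroup.heisenberg Complex.I) v)

/-- The operator `K₀ = -(i/2) dπ(2 i K₀)`. -/
noncomputable def KZero (π : JacobiGroup →* (H ≃ₗᵢ[ℂ] H)) (v : H) : H :=
  (-Complex.I / 2) • derived π JacobiGroup.rotation v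

/-- The operator `K₊ = (dπ(K₊ - K₋) - i dπ(i K₊ + i K₋)) / 2`. -/
noncomputable def KPlus (π : JacobiGroup →* (H ≃ₗᵢ[ℂ] H)) (v : H) : H :=
  (1 / 2 : ℂ) • (derived π (JacobiGroup.boost 1 (by simp)) v -
    Complex.I • derived π (JacobiGroup.boost Complex.I (by simp)) v)

/-- The operator `K₋ = -(dπ(K₊ - K₋) + i dπ(i K₊ + i K₋)) / 2`. -/
noncomputable def KMinus (π : JacobiGroup →* (H ≃ₗᵢ[ℂ] H)) (v : H) : H :=
  (-1 / 2 : ℂ) • (derived π (JacobiGroup.boost 1 (by simp)) v +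
    Complex.I • derived π (JacobiGroup.boost Complex.I (by simp)) v)

/-- The restriction `S` of the representation to `SU(1,1)`. -/
def S (π : JacobiGroup →* (H ≃ₗᵢ[ℂ] H)) (g : SU11) : H ≃ₗᵢ[ℂ] H := π ⟨g, 0, 0⟩

/-- The displacement operator `D(α) = exp (α a⁺ - ᾱ a)`, the value at `s = 1` of the unitary
one-parameter group with generator `α a⁺ - ᾱ a`. -/
def D (π : JacobiGroup →* (H ≃ₗᵢ[ℂ] H)) (α : ℂ) : H ≃ₗᵢ[ℂ] H :=
  π (JacobiGroup.heisenberg α 1)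

/-- The `n`-th term `(z a⁺ + w K₊)ⁿ e₀ / n!` of the exponential series of the coherent state. -/
noncomputable def coherentTerm (π : JacobiGroup →* (H ≃ₗᵢ[ℂ] H)) (e₀ : H) (z w : ℂ) (n : ℕ) : H :=
  ((n.factorial : ℂ)⁻¹) • ((fun v : H => z • create π v + w • KPlus π v)^[n] e₀)

/-- The coherent state vector `e_{z,w} = exp (z a⁺ + w K₊) e₀`. -/
noncomputable def coherentState (π : JacobiGroup →* (H ≃ₗᵢ[ℂ] H)) (e₀ : H) (z w : ℂ) : H :=
  ∑' n : ℕ, coherentTerm π e₀ z w n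

end JacobiRep

namespace JacobiGroup

/-- The manifold `ℂ × D₁` of pairs `(z, w)` with `|w| < 1`. -/
def domain : Set (ℂ × ℂ) := {p | ‖p.2‖ < 1}

/-- The point `(z₁, w₁)`, `z₁ = (α - ᾱ w + z) / (b̄ w + ā)`, `w₁ = (a w + b) / (b̄ w + ā)`. -/
noncomputable def act (h : JacobiGroup) (p : ℂ × ℂ) : ℂ × ℂ :=
  ((h.α - conj h.α * p.2 + p.1) / (conj h.g.b * p.2 + conj h.g.a),
    (h.g.a * p.2 + h.g.b) / (conj h.g.b * p.2 + conj h.g.a))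

/-- `α₀ = (z + z̄ w) / (1 - |w|²)`. -/
noncomputable def alphaZero (z w : ℂ) : ℂ := (z + conj z * w) / (1 - w * conj w)

/-- `α₂ = (α + α₀) a + (ᾱ + ᾱ₀) b`. -/
noncomputable def alphaTwo (g : SU11) (α z w : ℂ) : ℂ :=
  (α + alphaZero z w) * g.a + (conj α + conj (alphaZero z w)) * g.b

/-- `θ_h(α, β) = Im (α β̄)`. -/
noncomputable def thetaH (α β : ℂ) : ℝ := (α * conj β).im

/-- The factor `λ(g, α; z, w)`, with `m = 2k`. -/
noncomputable def factor (m : ℕ) (g : SU11) (α z w : ℂ) : ℂ :=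
  (conj g.a + conj g.b * w) ^ (-(m : ℤ)) *
    Complex.exp (z / 2 * conj (alphaZero z w) -
      (act ⟨g, α, 0⟩ (z, w)).1 / 2 * conj (alphaTwo g α z w)) *
    Complex.exp (Complex.I * (thetaH α (alphaZero z w) : ℂ))

/-- The multiplier on the whole Jacobi group, `(g, α, t) ↦ e^{it} λ(g, α; z, w)`. -/
noncomputable def multiplier (m : ℕ) (h : JacobiGroup) (p : ℂ × ℂ) : ℂ :=
  Complex.exp (Complex.I * (h.t : ℂ)) * factor m h.g h.α p.1 p.2

end JacobiGroup

/-!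
The coherent state vectors are the values of an equivariant holomorphic map.

The action on `ℂ × D₁` is an action because it becomes the affine plane action times the Möbius
action in the coordinates `(α₀, w)` (`alphaZero_act`). In the same coordinates the multiplier is an
automorphy factor, times a coboundary, times a phase governed by the invariant symplectic form, so
that the cocycle identity holds (`multiplier_mul`); it is holomorphic because the conjugates of `z`
and `w` cancel (`multiplier_eq`).

The stabilizer of the origin is the product of the centre and the rotation subgroup. By the
hypothesis on the centre and `K₀ e₀ = k e₀` it acts on `e₀` through the multiplier. Hence there is a
map `Φ : ℂ × D₁ → H` with `Φ(0, 0) = e₀` and `π(h) Φ(p) = J(h, p) Φ(h · p)`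
(`apply_equivariantMap`). It is smooth over `ℝ` since `e₀` is a smooth vector. The equations
`a e₀ = 0` and `K₋ e₀ = 0` are the Cauchy-Riemann equations of `Φ` at the origin, and by
equivariance `Φ` is holomorphic everywhere (`differentiableAt_equivariantMap`).

It remains to identify `Φ(z, w)` with `exp (z a⁺ + w K₊) e₀`. Differentiating the equivariance along
one-parameter subgroups shows that `a⁺` and `K₊` act on the values of `Φ` as `∂/∂z` and `∂/∂w`. The
generators of one-parameter unitary groups are closed operators, so they commute with
differentiation of holomorphic families of vectors (`iteratedDeriv_mem_generatorGraph`). Therefore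
`(z a⁺ + w K₊)ⁿ e₀` is the `n`-th derivative at `0` of `u ↦ Φ(u z, u w)`. This function is
holomorphic on the disc `|u| |w| < 1`, which contains `u = 1`, and the exponential series is its
Taylor series there (`hasSum_coherentTerm`).
-/

/-! ### The action on `ℂ × D₁` and its multiplier -/

namespace SU11

theorem norm_b_lt_norm_a (g : SU11) : ‖g.b‖ < ‖g.a‖ := by
  have h := g.a_mul_conj_sub
  rw [Complex.mul_conj, Complex.mul_conj, Complex.normSq_eq_norm_sq,
    Complex.normSq_eq_norm_sq] at h
  have h' : ‖g.a‖ ^ 2 - ‖g.b‖ ^ 2 = 1 := by exact_mod_cast h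
  nlinarith [norm_nonneg g.a, norm_nonneg g.b]

theorem denom_ne_zero (g : SU11) {w : ℂ} (hw : ‖w‖ < 1) : conj g.b * w + conj g.a ≠ 0 := by
  intro h
  have h1 : ‖conj g.b * w‖ = ‖g.a‖ := by
    rw [eq_neg_of_add_eq_zero_left h, norm_neg, RCLike.norm_conj]
  rw [norm_mul, RCLike.norm_conj] at h1
  nlinarith [g.norm_b_lt_norm_a, norm_nonneg g.b]

/-- The Möbius action preserves the disc, since `|b̄ w + ā|² - |a w + b|² = 1 - |w|²`. -/
theorem norm_mobius_lt_one (g : SU11) {w : ℂ} (hw : ‖w‖ < 1) :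
    ‖(g.a * w + g.b) / (conj g.b * w + conj g.a)‖ < 1 := by
  have hd := norm_pos_iff.2 (g.denom_ne_zero hw)
  rw [norm_div, div_lt_one hd]
  have key : (conj g.b * w + conj g.a) * conj (conj g.b * w + conj g.a)
      - (g.a * w + g.b) * conj (g.a * w + g.b) = 1 - w * conj w := by
    simp only [map_add, map_mul, Complex.conj_conj]
    linear_combination (1 - w * conj w) * g.a_mul_conj_sub
  simp only [Complex.mul_conj, Complex.normSq_eq_norm_sq] at key
  have key' : ‖conj g.b * w + conj g.a‖ ^ 2 - ‖g.a * w + g.b‖ ^ 2 = 1 - ‖w‖ ^ 2 := by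
    exact_mod_cast key
  nlinarith [norm_nonneg w, norm_nonneg (g.a * w + g.b)]

end SU11

namespace JacobiGroup

theorem one_sub_mul_conj_ne_zero {w : ℂ} (hw : ‖w‖ < 1) : 1 - w * conj w ≠ 0 := by
  rw [Complex.mul_conj, Complex.normSq_eq_norm_sq]
  have h : (1 - ‖w‖ ^ 2 : ℝ) ≠ 0 := by nlinarith [norm_nonneg w]
  exact_mod_cast h

theorem alphaZero_sub_mul_conj (z : ℂ) {w : ℂ} (hw : ‖w‖ < 1) :
    alphaZero z w - w * conj (alphaZero z w) = z := by
  have h := one_sub_mul_conj_ne_zero hw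
  have h' : 1 - conj w * w ≠ 0 := by rwa [mul_comm]
  simp only [alphaZero, map_div₀, map_sub, map_add, map_mul, map_one, Complex.conj_conj]
  field_simp
  ring

/-- The map `β ↦ β - w β̄` is inverse to `z ↦ α₀(z, w)`. -/
theorem alphaZero_eq_of_sub_mul_conj {z w β : ℂ} (hw : ‖w‖ < 1) (h : β - w * conj β = z) :
    alphaZero z w = β := by
  subst h
  rw [alphaZero, div_eq_iff (one_sub_mul_conj_ne_zero hw)]
  simp only [map_sub, map_mul, Complex.conj_conj]
  ring

theorem act_mem_domain (h : JacobiGroup) {p : ℂ × ℂ} (hp : p ∈ domain) : h.act p ∈ domain :=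
  h.g.norm_mobius_lt_one hp

/-- In the coordinates `(α₀, w)` the action is the affine plane action on the first factor and
the Möbius action on the second. -/
theorem alphaZero_act (h : JacobiGroup) {p : ℂ × ℂ} (hp : p ∈ domain) :
    alphaZero (h.act p).1 (h.act p).2 = h.g.planeAct (h.α + alphaZero p.1 p.2) := by
  refine alphaZero_eq_of_sub_mul_conj (h.act_mem_domain hp) ?_
  have hd := h.g.denom_ne_zero hp
  have hz := alphaZero_sub_mul_conj p.1 hp
  have hd' : p.2 * conj h.g.b + conj h.g.a ≠ 0 := by rwa [mul_comm p.2]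
  have hg := h.g.a_mul_conj_sub
  simp only [act, SU11.planeAct]
  generalize alphaZero p.1 p.2 = β at *
  rw [← hz]
  simp only [map_add, map_mul, Complex.conj_conj]
  field_simp
  linear_combination (h.α + β - p.2 * (conj h.α + conj β)) * hg

theorem alphaTwo_eq (h : JacobiGroup) {p : ℂ × ℂ} (hp : p ∈ domain) :
    alphaTwo h.g h.α p.1 p.2 = alphaZero (h.act p).1 (h.act p).2 := by
  rw [h.alphaZero_act hp, alphaTwo, SU11.planeAct, map_add]
  ring

theorem denom_mul (h₁ h₂ : JacobiGroup) {p : ℂ × ℂ} (hp : p ∈ domain) :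
    conj (h₁ * h₂).g.b * p.2 + conj (h₁ * h₂).g.a =
      (conj h₁.g.b * (h₂.act p).2 + conj h₁.g.a) * (conj h₂.g.b * p.2 + conj h₂.g.a) := by
  have hd := h₂.g.denom_ne_zero hp
  simp only [act, mul_g, SU11.a_mul, SU11.b_mul, map_add, map_mul, Complex.conj_conj]
  field_simp
  ring

theorem one_act (p : ℂ × ℂ) : (1 : JacobiGroup).act p = p := by
  simp [act]

theorem mul_act (h₁ h₂ : JacobiGroup) {p : ℂ × ℂ} (hp : p ∈ domain) :
    (h₁ * h₂).act p = h₁.act (h₂.act p) := by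
  have hp₂ := h₂.act_mem_domain hp
  have hp₁ := h₁.act_mem_domain hp₂
  have hp₁₂ := (h₁ * h₂).act_mem_domain hp
  have hw : ((h₁ * h₂).act p).2 = (h₁.act (h₂.act p)).2 := by
    have hd₂ := h₂.g.denom_ne_zero hp
    have hd₁ := h₁.g.denom_ne_zero hp₂
    have hd := (h₁ * h₂).g.denom_ne_zero hp
    have e := denom_mul h₁ h₂ hp
    change _ / (conj (h₁ * h₂).g.b * p.2 + conj (h₁ * h₂).g.a) =
      _ / (conj h₁.g.b * (h₂.act p).2 + conj h₁.g.a)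
    rw [e, div_eq_div_iff (mul_ne_zero hd₁ hd₂) hd₁]
    generalize conj h₁.g.b * (h₂.act p).2 + conj h₁.g.a = d₁
    simp only [act, mul_g, SU11.a_mul, SU11.b_mul]
    field_simp
    ring
  have hα : alphaZero ((h₁ * h₂).act p).1 ((h₁ * h₂).act p).2 =
      alphaZero (h₁.act (h₂.act p)).1 (h₁.act (h₂.act p)).2 := by
    rw [alphaZero_act _ hp, alphaZero_act _ hp₂, alphaZero_act _ hp, mul_g, mul_α,
      SU11.planeAct_mul]
    congr 1
    simp only [SU11.planeAct_add, ← SU11.planeAct_mul, mul_inv_cancel, SU11.planeAct_one]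
    ring
  refine Prod.ext ?_ hw
  rw [← alphaZero_sub_mul_conj ((h₁ * h₂).act p).1 hp₁₂,
    ← alphaZero_sub_mul_conj (h₁.act (h₂.act p)).1 hp₁, hα, hw]

theorem inv_act_act (h : JacobiGroup) {p : ℂ × ℂ} (hp : p ∈ domain) :
    h⁻¹.act (h.act p) = p := by
  rw [← mul_act _ _ hp, inv_mul_cancel, one_act]

theorem multiplier_ne_zero (m : ℕ) (h : JacobiGroup) {p : ℂ × ℂ} (hp : p ∈ domain) :
    h.multiplier m p ≠ 0 := by
  have hd := h.g.denom_ne_zero hp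
  rw [add_comm] at hd
  exact mul_ne_zero (Complex.exp_ne_zero _)
    (mul_ne_zero (mul_ne_zero (zpow_ne_zero _ hd) (Complex.exp_ne_zero _))
      (Complex.exp_ne_zero _))

/-- With `φ(z, w) = z ᾱ₀ / 2`, the multiplier is the automorphy factor of weight `m`, times the
coboundary `exp (φ(p) - φ(h p))`, times the phase `exp i (t + Im (α ᾱ₀))`. -/
theorem multiplier_eq_mul_exp (m : ℕ) (h : JacobiGroup) {p : ℂ × ℂ} (hp : p ∈ domain) :
    h.multiplier m p = (conj h.g.b * p.2 + conj h.g.a) ^ (-(m : ℤ)) *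
      Complex.exp (p.1 / 2 * conj (alphaZero p.1 p.2) -
        (h.act p).1 / 2 * conj (alphaZero (h.act p).1 (h.act p).2) +
        Complex.I * ((h.t + (h.α * conj (alphaZero p.1 p.2)).im : ℝ) : ℂ)) := by
  rw [← alphaTwo_eq h hp, multiplier, factor, thetaH, add_comm (conj h.g.a)]
  push_cast
  rw [mul_add, Complex.exp_add, Complex.exp_add]
  have e : (act ⟨h.g, h.α, 0⟩ (p.1, p.2)) = h.act p := rfl
  rw [e]
  ring

theorem multiplier_mul (m : ℕ) (h₁ h₂ : JacobiGroup) {p : ℂ × ℂ} (hp : p ∈ domain) :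
    (h₁ * h₂).multiplier m p = h₁.multiplier m (h₂.act p) * h₂.multiplier m p := by
  have hp₂ := h₂.act_mem_domain hp
  rw [multiplier_eq_mul_exp m _ hp, multiplier_eq_mul_exp m _ hp, multiplier_eq_mul_exp m _ hp₂,
    denom_mul _ _ hp, mul_zpow, mul_act _ _ hp, mul_mul_mul_comm, ← Complex.exp_add]
  congr 2
  -- the symplectic form is invariant under the plane action
  have key : (h₁.α * conj (alphaZero (h₂.act p).1 (h₂.act p).2)).im =
      ((h₂.g⁻¹).planeAct h₁.α * conj (h₂.α + alphaZero p.1 p.2)).im := by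
    rw [alphaZero_act _ hp, ← SU11.im_planeAct h₂.g⁻¹, SU11.planeAct_inv_self]
  have key' : (h₁ * h₂).t + ((h₁ * h₂).α * conj (alphaZero p.1 p.2)).im =
      (h₁.t + (h₁.α * conj (alphaZero (h₂.act p).1 (h₂.act p).2)).im) +
        (h₂.t + (h₂.α * conj (alphaZero p.1 p.2)).im) := by
    rw [key]
    simp only [mul_t, mul_α, map_add, mul_add, add_mul, Complex.add_im]
    ring
  rw [key']
  push_cast
  ring

/-- A formula for the multiplier in which only `z` and `w`, not their conjugates, occur. -/
theorem multiplier_eq (m : ℕ) (h : JacobiGroup) {p : ℂ × ℂ} (hp : p ∈ domain) :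
    h.multiplier m p = (conj h.g.b * p.2 + conj h.g.a) ^ (-(m : ℤ)) *
      Complex.exp (Complex.I * (h.t : ℂ) - h.α * conj h.α / 2 - conj h.α * p.1
        + p.2 * conj h.α ^ 2 / 2 - conj h.g.b * (p.1 + h.α - conj h.α * p.2) ^ 2
          / (2 * (conj h.g.b * p.2 + conj h.g.a))) := by
  rw [multiplier_eq_mul_exp m _ hp]
  congr 2
  have hd := h.g.denom_ne_zero hp
  have hd' : p.2 * conj h.g.b + conj h.g.a ≠ 0 := by rwa [mul_comm p.2]
  have hz := alphaZero_sub_mul_conj p.1 hp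
  rw [alphaZero_act _ hp]
  simp only [act, SU11.planeAct]
  generalize alphaZero p.1 p.2 = β at *
  have him : Complex.I * ((h.α * conj β).im : ℂ) = (h.α * conj β - conj h.α * β) / 2 := by
    rw [Complex.im_eq_sub_conj]
    simp only [map_mul, Complex.conj_conj]
    field_simp [Complex.I_ne_zero]
  push_cast
  rw [mul_add Complex.I, him, ← hz]
  simp only [map_add, map_mul, Complex.conj_conj]
  field_simp
  ring

theorem differentiableAt_act (h : JacobiGroup) {p : ℂ × ℂ} (hp : p ∈ domain) :
    DifferentiableAt ℂ h.act p := by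
  have hd := h.g.denom_ne_zero hp
  unfold act
  fun_prop (disch := assumption)

theorem isOpen_domain : IsOpen domain :=
  isOpen_lt (by fun_prop) continuous_const

theorem differentiableAt_multiplier (m : ℕ) (h : JacobiGroup) {p : ℂ × ℂ} (hp : p ∈ domain) :
    DifferentiableAt ℂ (h.multiplier m) p := by
  have hd := h.g.denom_ne_zero hp
  have hd2 : 2 * (conj h.g.b * p.2 + conj h.g.a) ≠ 0 := mul_ne_zero two_ne_zero hd
  have e : h.multiplier m =ᶠ[nhds p] fun p => _ :=
    Filter.eventually_of_mem (isOpen_domain.mem_nhds hp) fun q hq => multiplier_eq m h hq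
  refine DifferentiableAt.congr_of_eventuallyEq ?_ e
  have h1 : DifferentiableAt ℂ (fun p : ℂ × ℂ => conj h.g.b * p.2 + conj h.g.a) p := by fun_prop
  refine DifferentiableAt.mul (h1.zpow (Or.inl hd)) ?_
  fun_prop (disch := assumption)

end JacobiGroup

/-! ### One-parameter subgroups and orbit maps -/

namespace SU11

theorem rot_add (s t : ℝ) : rot (s + t) = rot s * rot t := by
  apply ext_ab
  · simp [rot, ← Complex.exp_add, add_mul]
  · simp [rot]

theorem boost_add (u : ℂ) (hu : u * conj u = 1) (s t : ℝ) :
    boost u hu (s + t) = boost u hu s * boost u hu t := by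
  apply ext_ab
  · simp only [boost, a_mul, a_mk, b_mk, Real.cosh_add, map_mul, Complex.conj_ofReal]
    push_cast
    linear_combination (-(Complex.sinh s * Complex.sinh t)) * hu
  · simp only [boost, b_mul, a_mk, b_mk, Real.sinh_add, Complex.conj_ofReal]
    push_cast
    ring

end SU11

namespace JacobiGroup

theorem heisenberg_add (α : ℂ) (s t : ℝ) :
    heisenberg α (s + t) = heisenberg α s * heisenberg α t := by
  ext1
  · simp [heisenberg]
  · simp [heisenberg, SU11.planeAct, add_mul]
  · simp [heisenberg, SU11.planeAct]
    ring

theorem rotation_add (s t : ℝ) : rotation (s + t) = rotation s * rotation t := by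
  ext1
  · simp [rotation, SU11.rot_add]
  · simp [rotation, SU11.planeAct]
  · simp [rotation, SU11.planeAct]

theorem boost_add (u : ℂ) (hu : u * conj u = 1) (s t : ℝ) :
    boost u hu (s + t) = boost u hu s * boost u hu t := by
  ext1
  · simp [boost, SU11.boost_add]
  · simp [boost, SU11.planeAct]
  · simp [boost, SU11.planeAct]

theorem zero_mem_domain : (0 : ℂ × ℂ) ∈ domain := by simp [domain]

/-- The stabilizer of the origin is the product of the centre and the rotation subgroup. -/
theorem eq_central_mul_rotation_of_act_zero {h : JacobiGroup} (h0 : h.act 0 = 0) :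
    h = ⟨1, 0, h.t⟩ * rotation h.g.a.arg ∧
      h.g.a = Complex.exp (h.g.a.arg * Complex.I) ∧ h.g.b = 0 ∧ h.α = 0 := by
  have ha : conj h.g.a ≠ 0 := by simpa using h.g.denom_ne_zero (w := 0) (by simp)
  have hα : h.α = 0 := by
    have := congrArg Prod.fst h0
    simpa [act, ha] using this
  have hb : h.g.b = 0 := by
    have := congrArg Prod.snd h0
    simpa [act, ha] using this
  have hn : ‖h.g.a‖ = 1 := by
    have e := h.g.a_mul_conj_sub
    rw [hb, zero_mul, sub_zero, Complex.mul_conj, Complex.normSq_eq_norm_sq] at e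
    have e' : ‖h.g.a‖ ^ 2 = 1 := by exact_mod_cast e
    nlinarith [norm_nonneg h.g.a]
  have hexp : h.g.a = Complex.exp (h.g.a.arg * Complex.I) := by
    have := Complex.norm_mul_exp_arg_mul_I h.g.a
    rw [hn] at this
    simpa using this.symm
  refine ⟨?_, hexp, hb, hα⟩
  ext1
  · apply SU11.ext_ab
    · simpa [rotation, SU11.rot] using hexp
    · simpa [rotation, SU11.rot] using hb
  · simp [rotation, SU11.planeAct, hα]
  · simp [rotation, SU11.planeAct]

theorem multiplier_of_act_zero (m : ℕ) {h : JacobiGroup} (h0 : h.act 0 = 0) :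
    h.multiplier m 0 = Complex.exp (Complex.I * (h.t : ℂ)) *
      Complex.exp (Complex.I * (m : ℂ) * (h.g.a.arg : ℂ)) := by
  obtain ⟨-, ha, hb, hα⟩ := eq_central_mul_rotation_of_act_zero h0
  have hc : conj h.g.a = Complex.exp (-(h.g.a.arg * Complex.I)) := by
    conv_lhs => rw [ha]
    rw [← Complex.exp_conj]
    simp
  rw [multiplier_eq m h zero_mem_domain]
  simp only [hb, hα, hc, map_zero, Prod.fst_zero, Prod.snd_zero]
  rw [mul_comm]
  congr 1
  · simp
  · rw [zero_mul, zero_add, ← Complex.exp_int_mul]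
    congr 1
    push_cast
    ring

/-- The scale `(1 - |w|²)^(-1/2)`. -/
noncomputable def radius (w : ℂ) : ℝ := (√(1 - ‖w‖ ^ 2))⁻¹

theorem radius_pos {w : ℂ} (hw : ‖w‖ < 1) : 0 < radius w :=
  inv_pos.2 (Real.sqrt_pos.2 (by nlinarith [norm_nonneg w]))

theorem radius_sq_mul {w : ℂ} (hw : ‖w‖ < 1) :
    (radius w : ℂ) * radius w * (1 - w * conj w) = 1 := by
  have h : 0 < 1 - ‖w‖ ^ 2 := by nlinarith [norm_nonneg w]
  have h' : radius w * radius w * (1 - ‖w‖ ^ 2) = 1 := by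
    rw [radius, ← mul_inv, Real.mul_self_sqrt h.le, inv_mul_cancel₀ h.ne']
  rw [Complex.mul_conj, Complex.normSq_eq_norm_sq]
  exact_mod_cast h'

/-- The section with `a = (1 - |w|²)^(-1/2)`, `b = a w`, `α = a z` of the orbit map
`h ↦ h · (0, 0)` over `ℂ × D₁`. Off this domain the value is the junk value `1`. -/
noncomputable def originSection (p : ℂ × ℂ) : JacobiGroup :=
  open Classical in
  if hp : ‖p.2‖ < 1 then
    ⟨SU11.mk (radius p.2) (p.2 * radius p.2) (by
      rw [map_mul, Complex.conj_ofReal]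
      linear_combination radius_sq_mul hp), radius p.2 * p.1, 0⟩
  else 1

theorem coords_originSection {p : ℂ × ℂ} (hp : p ∈ domain) :
    (originSection p).coords = ((radius p.2 : ℂ), p.2 * radius p.2, radius p.2 * p.1, 0) := by
  have hp' : ‖p.2‖ < 1 := hp
  simp [originSection, hp', coords]

theorem originSection_act {p : ℂ × ℂ} (hp : p ∈ domain) : (originSection p).act 0 = p := by
  have hp' : ‖p.2‖ < 1 := hp
  have hr : (radius p.2 : ℂ) ≠ 0 := by exact_mod_cast (radius_pos hp').ne'
  simp [originSection, hp', act, hr]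

theorem inv_multiplier_originSection (m : ℕ) {p : ℂ × ℂ} (hp : p ∈ domain) :
    ((originSection p).multiplier m 0)⁻¹ = (radius p.2 : ℂ) ^ m *
      Complex.exp ((radius p.2 : ℂ) ^ 2 * (p.1 * conj p.1 + conj p.2 * p.1 ^ 2) / 2) := by
  have hp' : ‖p.2‖ < 1 := hp
  have hr : (radius p.2 : ℂ) ≠ 0 := by exact_mod_cast (radius_pos hp').ne'
  rw [multiplier_eq m _ zero_mem_domain, mul_inv, ← Complex.exp_neg]
  simp only [originSection, hp', dif_pos, SU11.a_mk, SU11.b_mk, Prod.fst_zero, Prod.snd_zero,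
    map_mul, Complex.conj_ofReal, zpow_neg, zpow_natCast, mul_zero, zero_add, inv_inv]
  congr 2
  field_simp
  push_cast
  ring

end JacobiGroup

namespace JacobiRep

open JacobiGroup

variable {H : Type*} [NormedAddCommGroup H] [InnerProductSpace ℂ H]

theorem map_mul_apply (π : JacobiGroup →* (H ≃ₗᵢ[ℂ] H)) (h₁ h₂ : JacobiGroup) (v : H) :
    π (h₁ * h₂) v = π h₁ (π h₂ v) := by
  rw [map_mul]
  rfl

theorem hasDerivAt_orbit (π : JacobiGroup →* (H ≃ₗᵢ[ℂ] H)) {γ : ℝ → JacobiGroup}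
    (hγ : ∀ s t, γ (s + t) = γ s * γ t) {v y : H}
    (h : HasDerivAt (fun s => π (γ s) v) y 0) (s : ℝ) :
    HasDerivAt (fun s => π (γ s) v) (π (γ s) y) s := by
  have h1 : HasDerivAt (fun t => π (γ (t - s)) v) y s := by
    have := HasDerivAt.scomp s (g₁ := fun t => π (γ t) v) (h := fun t : ℝ => t - s) (h' := 1)
      (by simpa using h) ((hasDerivAt_id s).sub_const s)
    simpa [Function.comp_def] using this
  have h2 := ((π (γ s)).toContinuousLinearEquiv.toContinuousLinearMap.restrictScalars
    ℝ).hasFDerivAt.comp_hasDerivAt s h1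
  convert! h2 using 2 with t
  change _ = π (γ s) (π (γ (t - s)) v)
  rw [← map_mul_apply, ← hγ, add_sub_cancel]

/-- Along a curve which is differentiable in the coordinates of the Jacobi group, the orbit map of
a smooth vector is differentiable. -/
theorem IsSmoothVector.differentiableAt_orbit {π : JacobiGroup →* (H ≃ₗᵢ[ℂ] H)} {v : H}
    (hv : IsSmoothVector π v) {γ : ℝ → JacobiGroup} {s : ℝ}
    (hγ : DifferentiableAt ℝ (fun s => (γ s).coords) s) :
    DifferentiableAt ℝ (fun s => π (γ s) v) s := by
  obtain ⟨U, F, hU, hsub, hF, hFv⟩ := hv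
  have h1 : DifferentiableAt ℝ F (γ s).coords :=
    (hF.contDiffAt (hU.mem_nhds (hsub ⟨γ s, rfl⟩))).differentiableAt (by simp)
  have h2 := h1.comp s hγ
  simpa only [Function.comp_def, hFv] using h2

theorem differentiable_coords_rotation :
    Differentiable ℝ fun s => (JacobiGroup.rotation s).coords := by
  have h : Differentiable ℝ fun s : ℝ => (s : ℂ) := Complex.ofRealCLM.differentiable
  simp only [coords, JacobiGroup.rotation, SU11.rot, SU11.a_mk, SU11.b_mk]
  fun_prop

/-! ### The equivariant map of `ℂ × D₁` into the representation -/

/-- An eigenvector of `K₀` of eigenvalue `m / 2` is an eigenvector of weight `m` of the rotation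
subgroup. -/
theorem rotation_apply_of_KZero {π : JacobiGroup →* (H ≃ₗᵢ[ℂ] H)} {k : ℝ} {m : ℕ}
    (hk : 2 * k = m) {e₀ : H} (he : IsSmoothVector π e₀) (hK : KZero π e₀ = (k : ℂ) • e₀) (s : ℝ) :
    π (JacobiGroup.rotation s) e₀ = Complex.exp (Complex.I * (m : ℂ) * (s : ℂ)) • e₀ := by
  have hkm : (2 : ℂ) * k = m := by exact_mod_cast hk
  have hd0 : derived π JacobiGroup.rotation e₀ = (Complex.I * (m : ℂ)) • e₀ := by
    have h1 : derived π JacobiGroup.rotation e₀ = (2 * Complex.I) • KZero π e₀ := by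
      rw [KZero, smul_smul]
      have : 2 * Complex.I * (-Complex.I / 2) = 1 := by
        linear_combination -Complex.I_mul_I
      rw [this, one_smul]
    rw [h1, hK, smul_smul, ← hkm]
    congr 1
    ring
  have hd : HasDerivAt (fun s => π (JacobiGroup.rotation s) e₀) ((Complex.I * (m : ℂ)) • e₀) 0 := by
    rw [← hd0]
    exact (he.differentiableAt_orbit (differentiable_coords_rotation 0)).hasDerivAt
  have hd' := hasDerivAt_orbit π rotation_add hd
  -- the orbit, rotated back by the expected phase, is constant
  set f : ℝ → H := fun s =>
    Complex.exp (-(Complex.I * (m : ℂ)) * (s : ℂ)) • π (JacobiGroup.rotation s) e₀ with hf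
  have hf' : ∀ s, HasDerivAt f 0 s := by
    intro s
    have h1 : HasDerivAt (fun s : ℝ => Complex.exp (-(Complex.I * (m : ℂ)) * (s : ℂ)))
        (Complex.exp (-(Complex.I * (m : ℂ)) * (s : ℂ)) * (-(Complex.I * (m : ℂ)))) s := by
      have := ((Complex.ofRealCLM.hasDerivAt (x := s)).const_mul (-(Complex.I * (m : ℂ)))).cexp
      simpa using this
    convert! h1.smul (hd' s) using 1
    rw [map_smul, smul_smul, ← add_smul]
    simp
  have hconst := is_const_of_deriv_eq_zero (fun s => (hf' s).differentiableAt)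
    (fun s => (hf' s).deriv) s 0
  have h0 : f 0 = e₀ := by
    have : JacobiGroup.rotation 0 = 1 := by
      ext1
      · apply SU11.ext_ab <;> simp [JacobiGroup.rotation, SU11.rot]
      · rfl
      · rfl
    simp [hf, this]
  rw [h0] at hconst
  conv_rhs => rw [← hconst, hf]
  simp only [smul_smul, ← Complex.exp_add]
  simp

/-- The map `Φ` of `ℂ × D₁` into the representation space with `Φ (0, 0) = e₀` and
`π(h) Φ(p) = J(h, p) Φ(h · p)`. -/
noncomputable def equivariantMap (π : JacobiGroup →* (H ≃ₗᵢ[ℂ] H)) (m : ℕ) (e₀ : H)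
    (p : ℂ × ℂ) : H :=
  ((originSection p).multiplier m 0)⁻¹ • π (originSection p) e₀

section Equivariance

variable {π : JacobiGroup →* (H ≃ₗᵢ[ℂ] H)}
  (hcenter : ∀ (t : ℝ) (v : H), π ⟨1, 0, t⟩ v = Complex.exp (Complex.I * (t : ℂ)) • v)
  {k : ℝ} {m : ℕ} (hk : 2 * k = m) {e₀ : H} (he : IsSmoothVector π e₀)
  (hK : KZero π e₀ = (k : ℂ) • e₀)

include hcenter hk he hK

/-- The stabilizer of the origin acts on `e₀` through the multiplier. -/
theorem apply_of_act_zero {h : JacobiGroup} (h0 : h.act 0 = 0) :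
    π h e₀ = h.multiplier m 0 • e₀ := by
  conv_lhs => rw [(eq_central_mul_rotation_of_act_zero h0).1]
  rw [multiplier_of_act_zero m h0, map_mul_apply, rotation_apply_of_KZero hk he hK, map_smul,
    hcenter, smul_smul, mul_comm]

theorem apply_eq_multiplier_smul_equivariantMap (h : JacobiGroup) :
    π h e₀ = h.multiplier m 0 • equivariantMap π m e₀ (h.act 0) := by
  have hp : h.act 0 ∈ domain := h.act_mem_domain zero_mem_domain
  set σ := originSection (h.act 0)
  have hσ : σ.act 0 = h.act 0 := originSection_act hp
  have hr : (σ⁻¹ * h).act 0 = 0 := by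
    rw [mul_act _ _ zero_mem_domain, ← hσ, inv_act_act _ zero_mem_domain]
  have hh : h = σ * (σ⁻¹ * h) := by group
  have e1 : π h e₀ = (σ⁻¹ * h).multiplier m 0 • π σ e₀ := by
    conv_lhs => rw [hh, map_mul_apply,
      apply_of_act_zero hcenter hk he hK hr, map_smul]
  have e2 : h.multiplier m 0 = σ.multiplier m 0 * (σ⁻¹ * h).multiplier m 0 := by
    conv_lhs => rw [hh, multiplier_mul m _ _ zero_mem_domain, hr]
  rw [e1, e2, equivariantMap, smul_smul]
  congr 1
  have := multiplier_ne_zero m σ zero_mem_domain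
  change _ = _ * (σ.multiplier m 0)⁻¹
  field_simp

theorem apply_equivariantMap (h : JacobiGroup) {p : ℂ × ℂ} (hp : p ∈ domain) :
    π h (equivariantMap π m e₀ p) =
      h.multiplier m p • equivariantMap π m e₀ (h.act p) := by
  have hJ := multiplier_ne_zero m (originSection p) zero_mem_domain
  have key := apply_eq_multiplier_smul_equivariantMap hcenter hk he hK (h * originSection p)
  rw [map_mul_apply, multiplier_mul m _ _ zero_mem_domain,
    mul_act _ _ zero_mem_domain, originSection_act hp] at key
  rw [equivariantMap, map_smul, key, smul_smul]
  congr 1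
  field_simp

theorem equivariantMap_zero : equivariantMap π m e₀ 0 = e₀ := by
  have := apply_eq_multiplier_smul_equivariantMap hcenter hk he hK 1
  rw [one_act, multiplier_eq m _ zero_mem_domain] at this
  simpa using this.symm

end Equivariance

end JacobiRep

/-! ### Infinitesimal action along one-parameter subgroups -/

namespace JacobiGroup

theorem hasDerivAt_zero_comp_ofReal {f : ℂ → ℂ} {f' : ℂ} (h : HasDerivAt f f' 0) :
    HasDerivAt (fun s : ℝ => f s) f' 0 :=
  HasDerivAt.comp_ofReal (z := 0) (by rwa [Complex.ofReal_zero])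

theorem hasDerivAt_act_heisenberg (α : ℂ) (p : ℂ × ℂ) :
    HasDerivAt (fun s => (heisenberg α s).act p) (α - conj α * p.2, (0 : ℂ)) 0 := by
  have h1 : HasDerivAt (fun s : ℂ => s * (α - conj α * p.2) + p.1) (α - conj α * p.2) 0 := by
    simpa using ((hasDerivAt_id (0 : ℂ)).mul_const (α - conj α * p.2)).add_const p.1
  convert! (hasDerivAt_zero_comp_ofReal h1).prodMk (hasDerivAt_const (0 : ℝ) p.2) using 2 with s
  simp [act, heisenberg]
  ring

theorem hasDerivAt_multiplier_heisenberg (m : ℕ) (α : ℂ) {p : ℂ × ℂ} (hp : p ∈ domain) :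
    HasDerivAt (fun s => (heisenberg α s).multiplier m p) (-(conj α * p.1)) 0 := by
  have h1 : HasDerivAt (fun s : ℂ => Complex.exp (s * -(conj α * p.1) +
      s ^ 2 * (p.2 * conj α ^ 2 / 2 - α * conj α / 2))) (-(conj α * p.1)) 0 := by
    have e1 := (hasDerivAt_id (0 : ℂ)).mul_const (-(conj α * p.1))
    have e2 := ((hasDerivAt_id (0 : ℂ)).pow 2).mul_const (p.2 * conj α ^ 2 / 2 - α * conj α / 2)
    simpa using (e1.add e2).cexp
  convert! hasDerivAt_zero_comp_ofReal h1 using 2 with s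
  rw [multiplier_eq m _ hp]
  simp only [heisenberg, SU11.a_one, SU11.b_one, map_zero, map_one, zero_mul, zero_add, one_zpow,
    one_mul, map_mul, Complex.conj_ofReal]
  congr 1
  push_cast
  ring

theorem hasDerivAt_boost_denom (u w : ℂ) :
    HasDerivAt (fun s : ℂ => conj u * Complex.sinh s * w + Complex.cosh s) (conj u * w) 0 := by
  refine ((((Complex.hasDerivAt_sinh 0).const_mul (conj u)).mul_const w).add
    (Complex.hasDerivAt_cosh 0)).congr_deriv ?_
  simp

theorem hasDerivAt_act_boost (u : ℂ) (hu : u * conj u = 1) (p : ℂ × ℂ) :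
    HasDerivAt (fun s => (boost u hu s).act p)
      (-(conj u * p.2 * p.1), u - conj u * p.2 ^ 2) 0 := by
  have hD := hasDerivAt_boost_denom u p.2
  have hD0 : conj u * Complex.sinh 0 * p.2 + Complex.cosh 0 ≠ 0 := by simp
  have h1 : HasDerivAt (fun s : ℂ => p.1 / (conj u * Complex.sinh s * p.2 + Complex.cosh s))
      (-(conj u * p.2 * p.1)) 0 := by
    refine ((hasDerivAt_const (0 : ℂ) p.1).div hD hD0).congr_deriv ?_
    simp
    ring
  have h2 : HasDerivAt (fun s : ℂ => (Complex.cosh s * p.2 + u * Complex.sinh s) /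
      (conj u * Complex.sinh s * p.2 + Complex.cosh s)) (u - conj u * p.2 ^ 2) 0 := by
    refine ((((Complex.hasDerivAt_cosh 0).mul_const p.2).add
      ((Complex.hasDerivAt_sinh 0).const_mul u)).div hD hD0).congr_deriv ?_
    simp
    ring
  convert! (hasDerivAt_zero_comp_ofReal h1).prodMk (hasDerivAt_zero_comp_ofReal h2)
    using 2 with s
  simp only [act, boost, SU11.boost, SU11.a_mk, SU11.b_mk, map_mul, Complex.conj_ofReal]
  simp

theorem hasDerivAt_multiplier_boost (m : ℕ) (u : ℂ) (hu : u * conj u = 1) {p : ℂ × ℂ}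
    (hp : p ∈ domain) :
    HasDerivAt (fun s => (boost u hu s).multiplier m p)
      (-(conj u * (m * p.2 + p.1 ^ 2 / 2))) 0 := by
  have hD := hasDerivAt_boost_denom u p.2
  have hD0 : conj u * Complex.sinh 0 * p.2 + Complex.cosh 0 ≠ 0 := by simp
  have h1 : HasDerivAt
      (fun s : ℂ => ((conj u * Complex.sinh s * p.2 + Complex.cosh s) ^ m)⁻¹) (-(m * conj u * p.2))
      0 := by
    refine ((hD.pow m).inv (pow_ne_zero m hD0)).congr_deriv ?_
    simp
    ring
  have h2 : HasDerivAt (fun s : ℂ => -(conj u * Complex.sinh s * p.1 ^ 2 /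
      (2 * (conj u * Complex.sinh s * p.2 + Complex.cosh s)))) (-(conj u * (p.1 ^ 2 / 2))) 0 := by
    refine ((((Complex.hasDerivAt_sinh 0).const_mul (conj u)).mul_const (p.1 ^ 2)).div
      (hD.const_mul 2) (mul_ne_zero two_ne_zero hD0)).neg.congr_deriv ?_
    simp
    ring
  have h3 := (hasDerivAt_zero_comp_ofReal h1).mul (hasDerivAt_zero_comp_ofReal h2).cexp
  refine (h3.congr_deriv ?_).congr_of_eventuallyEq (Filter.Eventually.of_forall fun s => ?_)
  · simp
    ring
  · change multiplier m _ p = _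
    rw [multiplier_eq m _ hp]
    simp only [boost, SU11.boost, SU11.a_mk, SU11.b_mk, map_mul, Complex.conj_ofReal]
    simp

end JacobiGroup

/-! ### Holomorphy of the equivariant map -/

namespace JacobiRep

open JacobiGroup

variable {H : Type*} [NormedAddCommGroup H] [InnerProductSpace ℂ H]

theorem contDiffAt_radius {p : ℂ × ℂ} (hp : p ∈ domain) :
    ContDiffAt ℝ ∞ (fun q : ℂ × ℂ => (radius q.2 : ℂ)) p := by
  have hp' : 0 < 1 - ‖p.2‖ ^ 2 := by
    have : ‖p.2‖ < 1 := hp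
    nlinarith [norm_nonneg p.2]
  have h1 : ContDiffAt ℝ ∞ (fun q : ℂ × ℂ => 1 - ‖q.2‖ ^ 2) p :=
    contDiffAt_const.sub (contDiffAt_snd.norm_sq ℝ)
  exact Complex.ofRealCLM.contDiff.contDiffAt.comp p
    ((h1.sqrt hp'.ne').inv (Real.sqrt_pos.2 hp').ne')

theorem contDiffAt_equivariantMap {π : JacobiGroup →* (H ≃ₗᵢ[ℂ] H)} {e₀ : H}
    (he : IsSmoothVector π e₀) (m : ℕ) {p : ℂ × ℂ} (hp : p ∈ domain) :
    ContDiffAt ℝ ∞ (equivariantMap π m e₀) p := by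
  obtain ⟨U, F, hU, hsub, hF, hFv⟩ := he
  have hr := contDiffAt_radius hp
  have hc1 : ContDiffAt ℝ ∞ (fun q : ℂ × ℂ => conj q.1) p :=
    Complex.conjCLE.contDiff.contDiffAt.comp p contDiffAt_fst
  have hc2 : ContDiffAt ℝ ∞ (fun q : ℂ × ℂ => conj q.2) p :=
    Complex.conjCLE.contDiff.contDiffAt.comp p contDiffAt_snd
  have h1 : ContDiffAt ℝ ∞ (fun q : ℂ × ℂ => (radius q.2 : ℂ) ^ m *
      Complex.exp ((radius q.2 : ℂ) ^ 2 * (q.1 * conj q.1 + conj q.2 * q.1 ^ 2) / 2)) p := by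
    refine (hr.pow m).mul (ContDiffAt.cexp ?_)
    exact ((hr.pow 2).mul ((contDiffAt_fst.mul hc1).add
      (hc2.mul (contDiffAt_fst.pow 2)))).div_const 2
  have h2 : ContDiffAt ℝ ∞ (fun q : ℂ × ℂ =>
      ((radius q.2 : ℂ), q.2 * (radius q.2 : ℂ), (radius q.2 : ℂ) * q.1, (0 : ℝ))) p :=
    hr.prodMk ((contDiffAt_snd.mul hr).prodMk ((hr.mul contDiffAt_fst).prodMk contDiffAt_const))
  have h3 : ContDiffAt ℝ ∞ F
      ((radius p.2 : ℂ), p.2 * (radius p.2 : ℂ), (radius p.2 : ℂ) * p.1, (0 : ℝ)) := by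
    rw [← coords_originSection hp]
    exact hF.contDiffAt (hU.mem_nhds (hsub ⟨_, rfl⟩))
  refine (h1.smul (h3.comp p h2)).congr_of_eventuallyEq ?_
  filter_upwards [isOpen_domain.mem_nhds hp] with q hq
  rw [equivariantMap, inv_multiplier_originSection m hq, ← hFv, coords_originSection hq]
  rfl

/-- A function of two complex variables is holomorphic at a point where it is differentiable over
`ℝ` and satisfies the Cauchy-Riemann equations in both variables. -/
theorem differentiableAt_complex_prod_of_cauchyRiemann {f : ℂ × ℂ → H} {p : ℂ × ℂ}
    (hf : DifferentiableAt ℝ f p)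
    (h₁ : fderiv ℝ f p (Complex.I, 0) = Complex.I • fderiv ℝ f p (1, 0))
    (h₂ : fderiv ℝ f p (0, Complex.I) = Complex.I • fderiv ℝ f p (0, 1)) :
    DifferentiableAt ℂ f p := by
  rw [differentiableAt_iff_restrictScalars ℝ hf]
  set L := fderiv ℝ f p
  have e (x : ℂ × ℂ) : L x = L (x.1, 0) + L (0, x.2) := by
    rw [← map_add]
    simp
  have hs : ∀ (c : ℂ) (x : ℂ × ℂ), L (c • x) = c • L x := by
    intro c x
    have e1 := real_linearMap_map_smul_complex
      (ℓ := (L.comp (ContinuousLinearMap.inl ℝ ℂ ℂ)).toLinearMap) (by simpa using h₁) c x.1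
    have e2 := real_linearMap_map_smul_complex
      (ℓ := (L.comp (ContinuousLinearMap.inr ℝ ℂ ℂ)).toLinearMap) (by simpa using h₂) c x.2
    simp only [ContinuousLinearMap.coe_coe, ContinuousLinearMap.comp_apply,
      ContinuousLinearMap.inl_apply, ContinuousLinearMap.inr_apply] at e1 e2
    rw [e, e x, smul_add, ← e1, ← e2]
    rfl
  exact ⟨{ toFun := L, map_add' := L.map_add, map_smul' := hs, cont := L.cont }, rfl⟩

section Equivariance

variable {π : JacobiGroup →* (H ≃ₗᵢ[ℂ] H)}
  (hcenter : ∀ (t : ℝ) (v : H), π ⟨1, 0, t⟩ v = Complex.exp (Complex.I * (t : ℂ)) • v)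
  {k : ℝ} {m : ℕ} (hk : 2 * k = m) {e₀ : H} (he : IsSmoothVector π e₀)
  (hK : KZero π e₀ = (k : ℂ) • e₀)

include hcenter hk he hK

/-- The equivariance of `Φ`, differentiated along a curve `γ` through the identity with
`d/ds J(γ s, p) = c` and `d/ds (γ s · p) = ξ` at `s = 0`. -/
theorem hasDerivAt_apply_equivariantMap {γ : ℝ → JacobiGroup} (hγ : γ 0 = 1) {p ξ : ℂ × ℂ} {c : ℂ}
    (hp : p ∈ domain) (hJ : HasDerivAt (fun s => (γ s).multiplier m p) c 0)
    (hact : HasDerivAt (fun s => (γ s).act p) ξ 0) :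
    HasDerivAt (fun s => π (γ s) (equivariantMap π m e₀ p))
      (c • equivariantMap π m e₀ p + fderiv ℝ (equivariantMap π m e₀) p ξ) 0 := by
  have h0 : (γ 0).act p = p := by rw [hγ, one_act]
  have hJ0 : (γ 0).multiplier m p = 1 := by
    rw [hγ, multiplier_eq m _ hp]
    simp
  have hΦ : HasFDerivAt (equivariantMap π m e₀) (fderiv ℝ (equivariantMap π m e₀) p)
      ((γ 0).act p) := by
    rw [h0]
    exact ((contDiffAt_equivariantMap he m hp).differentiableAt (by simp)).hasFDerivAt
  have h := hJ.smul (hΦ.comp_hasDerivAt (0 : ℝ) hact)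
  simp only [Function.comp_apply, h0, hJ0, one_smul] at h
  rw [add_comm]
  refine h.congr_of_eventuallyEq (Filter.Eventually.of_forall fun s => ?_)
  exact apply_equivariantMap hcenter hk he hK (γ s) hp

theorem hasDerivAt_heisenberg_equivariantMap (α : ℂ) {p : ℂ × ℂ} (hp : p ∈ domain) :
    HasDerivAt (fun s => π (heisenberg α s) (equivariantMap π m e₀ p))
      ((-(conj α * p.1)) • equivariantMap π m e₀ p +
        fderiv ℝ (equivariantMap π m e₀) p (α - conj α * p.2, 0)) 0 := by
  refine hasDerivAt_apply_equivariantMap hcenter hk he hK ?_ hp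
    (hasDerivAt_multiplier_heisenberg m α hp) (hasDerivAt_act_heisenberg α p)
  ext1 <;> simp [heisenberg]

theorem hasDerivAt_boost_equivariantMap (u : ℂ) (hu : u * conj u = 1) {p : ℂ × ℂ}
    (hp : p ∈ domain) :
    HasDerivAt (fun s => π (boost u hu s) (equivariantMap π m e₀ p))
      ((-(conj u * (m * p.2 + p.1 ^ 2 / 2))) • equivariantMap π m e₀ p +
        fderiv ℝ (equivariantMap π m e₀) p (-(conj u * p.2 * p.1), u - conj u * p.2 ^ 2)) 0 := by
  refine hasDerivAt_apply_equivariantMap hcenter hk he hK ?_ hp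
    (hasDerivAt_multiplier_boost m u hu hp) (hasDerivAt_act_boost u hu p)
  ext1
  · apply SU11.ext_ab <;> simp [boost, SU11.boost]
  · rfl
  · rfl

variable (ha : annihilate π e₀ = 0) (hKm : KMinus π e₀ = 0)

include ha hKm

/-- At the origin the Cauchy-Riemann equations in `z` and `w` are `a e₀ = 0` and `K₋ e₀ = 0`. -/
theorem differentiableAt_equivariantMap_zero :
    DifferentiableAt ℂ (equivariantMap π m e₀) 0 := by
  have aux {x y : H} (h : (-1 / 2 : ℂ) • (x + Complex.I • y) = 0) : y = Complex.I • x := by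
    have h' : x + Complex.I • y = 0 := (smul_eq_zero.1 h).resolve_left (by norm_num)
    rw [eq_neg_of_add_eq_zero_left h', smul_neg, smul_smul, Complex.I_mul_I]
    simp
  have hΦ0 := equivariantMap_zero hcenter hk he hK
  have hh (α : ℂ) := (hasDerivAt_heisenberg_equivariantMap hcenter hk he hK α
    zero_mem_domain).deriv
  have hb (u : ℂ) (hu : u * conj u = 1) := (hasDerivAt_boost_equivariantMap hcenter hk he hK u hu
    zero_mem_domain).deriv
  simp only [hΦ0, Prod.fst_zero, Prod.snd_zero] at hh hb
  refine differentiableAt_complex_prod_of_cauchyRiemann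
    ((contDiffAt_equivariantMap he m zero_mem_domain).differentiableAt (by simp)) ?_ ?_
  · simp only [annihilate, derived, hh] at ha
    simpa using aux ha
  · simp only [KMinus, derived, hb] at hKm
    simpa using aux hKm

theorem differentiableAt_equivariantMap {p : ℂ × ℂ} (hp : p ∈ domain) :
    DifferentiableAt ℂ (equivariantMap π m e₀) p := by
  -- the value at `q` is determined by the value at `h · q`, where `h` carries `p` to the origin
  set h := (originSection p)⁻¹
  have h0 : h.act p = 0 := by
    conv_lhs => rw [← originSection_act hp]
    exact inv_act_act _ zero_mem_domain
  have hd : DifferentiableAt ℂ (equivariantMap π m e₀) (h.act p) := by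
    rw [h0]
    exact differentiableAt_equivariantMap_zero hcenter hk he hK ha hKm
  have h1 := (differentiableAt_multiplier m h hp).smul (hd.comp p (differentiableAt_act h hp))
  have h2 := (π h).symm.toContinuousLinearEquiv.differentiableAt.comp p h1
  refine h2.congr_of_eventuallyEq ?_
  filter_upwards [isOpen_domain.mem_nhds hp] with q hq
  exact ((π h).symm_apply_eq.2 (apply_equivariantMap hcenter hk he hK h hq).symm).symm

end Equivariance

end JacobiRep

/-! ### Generators of one-parameter subgroups and holomorphic families of vectors -/

/-- A complex-linear closed relation is preserved by differentiation of holomorphic families. -/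
theorem HasDerivAt.mem_of_isClosed_submodule {E : Type*} [NormedAddCommGroup E] [NormedSpace ℂ E]
    {Γ : Submodule ℂ E} (hΓ : IsClosed (Γ : Set E)) {f : ℂ → E} {f' : E} {x : ℂ}
    (hf : HasDerivAt f f' x) (hmem : ∀ᶠ y in nhds x, f y ∈ Γ) : f' ∈ Γ := by
  refine hΓ.mem_of_tendsto hf.tendsto_slope ?_
  filter_upwards [hmem.filter_mono nhdsWithin_le_nhds] with y hy
  exact Γ.smul_mem _ (Γ.sub_mem hy hmem.self_of_nhds)

theorem DifferentiableOn.iteratedDeriv_complex {E : Type*} [NormedAddCommGroup E]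
    [NormedSpace ℂ E] [CompleteSpace E] {f : ℂ → E} {U : Set ℂ} (hU : IsOpen U)
    (hf : DifferentiableOn ℂ f U) (n : ℕ) : DifferentiableOn ℂ (iteratedDeriv n f) U := by
  induction n with
  | zero => rwa [iteratedDeriv_zero]
  | succ n ih =>
    rw [iteratedDeriv_succ]
    exact ih.deriv hU

theorem DifferentiableOn.hasDerivAt_iteratedDeriv {E : Type*} [NormedAddCommGroup E]
    [NormedSpace ℂ E] [CompleteSpace E] {f : ℂ → E} {U : Set ℂ} (hU : IsOpen U)
    (hf : DifferentiableOn ℂ f U) (n : ℕ) {u : ℂ} (hu : u ∈ U) :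
    HasDerivAt (iteratedDeriv n f) (iteratedDeriv (n + 1) f u) u := by
  rw [iteratedDeriv_succ]
  exact ((hf.iteratedDeriv_complex hU n).differentiableAt (hU.mem_nhds hu)).hasDerivAt

theorem DifferentiableAt.fderiv_real_smul {H : Type*} [NormedAddCommGroup H]
    [InnerProductSpace ℂ H] {f : ℂ × ℂ → H} {p : ℂ × ℂ} (hf : DifferentiableAt ℂ f p) (c : ℂ)
    (v : ℂ × ℂ) : fderiv ℝ f p (c • v) = c • fderiv ℝ f p v := by
  rw [hf.fderiv_restrictScalars ℝ]
  exact map_smul (fderiv ℂ f p) c v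

/-- The directional derivatives of a holomorphic function of two variables which is twice
continuously differentiable over `ℝ` are holomorphic, because the second derivative is symmetric and
complex-linear in one of its arguments. -/
theorem differentiableAt_complex_fderiv_apply {H : Type*} [NormedAddCommGroup H]
    [InnerProductSpace ℂ H] {f : ℂ × ℂ → H} {p : ℂ × ℂ} (hf : ContDiffAt ℝ 2 f p)
    (hd : ∀ᶠ q in nhds p, DifferentiableAt ℂ f q) (v : ℂ × ℂ) :
    DifferentiableAt ℂ (fun q => fderiv ℝ f q v) p := by
  have hdiff : DifferentiableAt ℝ (fderiv ℝ f) p :=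
    (hf.fderiv_right (m := 1) (by norm_num)).differentiableAt (by simp)
  set B := fderiv ℝ (fderiv ℝ f) p
  have happ (v : ℂ × ℂ) : HasFDerivAt (fun q => fderiv ℝ f q v) (B.flip v) p :=
    (ContinuousLinearMap.apply ℝ H v).hasFDerivAt.comp p hdiff.hasFDerivAt
  have hsymm (x y : ℂ × ℂ) : B x y = B y x := hf.isSymmSndFDerivAt (by simp) x y
  have hlin (c : ℂ) (x y : ℂ × ℂ) : B x (c • y) = c • B x y := by
    have h1 := (happ y).const_smul c
    have h2 := (happ (c • y)).congr_of_eventuallyEq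
      (f₁ := fun q => c • fderiv ℝ f q y) (hd.mono fun q hq => (hq.fderiv_real_smul c y).symm)
    have := congrArg (fun L : ℂ × ℂ →L[ℝ] H => L x) (h2.unique h1)
    simpa using this
  rw [differentiableAt_iff_restrictScalars ℝ (happ v).differentiableAt, (happ v).fderiv]
  exact ⟨{ toFun := fun x => B x v
           map_add' := fun x y => by simp
           map_smul' := fun c x => by simp [hsymm _ v, hlin]
           cont := (B.flip v).cont }, rfl⟩

namespace JacobiRep

open JacobiGroup

variable {H : Type*} [NormedAddCommGroup H] [InnerProductSpace ℂ H]

/-- The graph of the infinitesimal generator of `s ↦ π (γ s)`. -/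
def generatorGraph (π : JacobiGroup →* (H ≃ₗᵢ[ℂ] H)) (γ : ℝ → JacobiGroup) :
    Submodule ℂ (H × H) where
  carrier := {x | HasDerivAt (fun s => π (γ s) x.1) x.2 0}
  add_mem' := by
    intro x y hx hy
    simpa using HasDerivAt.fun_add hx hy
  zero_mem' := by simpa using hasDerivAt_const (0 : ℝ) (0 : H)
  smul_mem' := by
    intro c x hx
    simpa using HasDerivAt.fun_const_smul c hx

theorem mem_generatorGraph {π : JacobiGroup →* (H ≃ₗᵢ[ℂ] H)} {γ : ℝ → JacobiGroup} {x : H × H} :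
    x ∈ generatorGraph π γ ↔ HasDerivAt (fun s => π (γ s) x.1) x.2 0 :=
  Iff.rfl

/-- The generator is a closed operator: `π` is isometric, so if `yₙ → y` then
`π (γ s) yₙ → π (γ s) y` uniformly in `s`, and derivatives pass to the limit. -/
theorem isClosed_generatorGraph (π : JacobiGroup →* (H ≃ₗᵢ[ℂ] H)) {γ : ℝ → JacobiGroup}
    (hγ : ∀ s t, γ (s + t) = γ s * γ t) : IsClosed (generatorGraph π γ : Set (H × H)) := by
  have hγ0 : γ 0 = 1 := by simpa using hγ 0 0
  refine isClosed_of_closure_subset fun x hx => ?_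
  obtain ⟨y, hy, hyx⟩ := mem_closure_iff_seq_limit.1 hx
  have h1 := (Prod.tendsto_iff _ _).1 hyx
  have key := hasDerivAt_of_tendstoUniformly (l := Filter.atTop)
    (f := fun n s => π (γ s) (y n).1) (f' := fun n s => π (γ s) (y n).2)
    (g := fun s => π (γ s) x.1) (g' := fun s => π (γ s) x.2) ?_
    (Filter.Eventually.of_forall fun n s => hasDerivAt_orbit π hγ (hy n) s)
    (fun s => ((π (γ s)).continuous.tendsto _).comp h1.1) 0
  · rw [hγ0, map_one] at key
    exact key
  · refine Metric.tendstoUniformly_iff.2 fun ε hε => ?_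
    filter_upwards [Metric.tendsto_nhds.1 h1.2 ε hε] with n hn s
    rwa [LinearIsometryEquiv.dist_map, dist_comm]

/-- If the generator along `γ` maps a holomorphic family `ψ` to the holomorphic family
`α A + ᾱ B`, the same relation holds between the derivatives of these families. -/
theorem iteratedDeriv_mem_generatorGraph [CompleteSpace H] {π : JacobiGroup →* (H ≃ₗᵢ[ℂ] H)}
    {γ : ℝ → JacobiGroup} (hγ : ∀ s t, γ (s + t) = γ s * γ t) {U : Set ℂ} (hU : IsOpen U)
    {ψ A B : ℂ → H} (hψ : DifferentiableOn ℂ ψ U) (hA : DifferentiableOn ℂ A U)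
    (hB : DifferentiableOn ℂ B U) (α : ℂ)
    (h : ∀ u ∈ U, (ψ u, α • A u + conj α • B u) ∈ generatorGraph π γ) (n : ℕ) :
    ∀ u ∈ U, (iteratedDeriv n ψ u, α • iteratedDeriv n A u + conj α • iteratedDeriv n B u) ∈
      generatorGraph π γ := by
  induction n with
  | zero => simpa only [iteratedDeriv_zero] using h
  | succ n ih =>
    intro u hu
    have h1 := (hψ.hasDerivAt_iteratedDeriv hU n hu).prodMk
      (((hA.hasDerivAt_iteratedDeriv hU n hu).const_smul α).add
        ((hB.hasDerivAt_iteratedDeriv hU n hu).const_smul (conj α)))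
    exact h1.mem_of_isClosed_submodule (isClosed_generatorGraph π hγ)
      (Filter.eventually_of_mem (hU.mem_nhds hu) ih)

/-- The creation operator extracts the part of `α a⁺ - ᾱ a` that is complex-linear in `α`. -/
theorem create_eq_of_mem_generatorGraph {π : JacobiGroup →* (H ≃ₗᵢ[ℂ] H)} {v A B : H}
    (h : ∀ α : ℂ, (v, α • A + conj α • B) ∈ generatorGraph π (heisenberg α)) :
    create π v = A := by
  have h1 : derived π (heisenberg 1) v = _ := (mem_generatorGraph.1 (h 1)).deriv
  have h2 : derived π (heisenberg Complex.I) v = _ := (mem_generatorGraph.1 (h Complex.I)).deriv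
  rw [create, h1, h2]
  simp only [smul_add, smul_smul, Complex.conj_I, map_one, one_smul, mul_neg, Complex.I_mul_I,
    neg_neg]
  module

theorem KPlus_eq_of_mem_generatorGraph {π : JacobiGroup →* (H ≃ₗᵢ[ℂ] H)} {v A B : H}
    (h : ∀ (u : ℂ) (hu : u * conj u = 1), (v, u • A + conj u • B) ∈ generatorGraph π (boost u hu)) :
    KPlus π v = A := by
  have h1 : derived π (boost 1 (by simp)) v = _ := (mem_generatorGraph.1 (h 1 (by simp))).deriv
  have h2 : derived π (boost Complex.I (by simp)) v = _ :=
    (mem_generatorGraph.1 (h Complex.I (by simp))).deriv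
  rw [KPlus, h1, h2]
  simp only [smul_add, smul_smul, Complex.conj_I, map_one, one_smul, mul_neg, Complex.I_mul_I,
    neg_neg]
  module

/-! ### Coherent state vectors as Taylor series -/

section CoherentStates

variable [CompleteSpace H] {π : JacobiGroup →* (H ≃ₗᵢ[ℂ] H)}
  (hcenter : ∀ (t : ℝ) (v : H), π ⟨1, 0, t⟩ v = Complex.exp (Complex.I * (t : ℂ)) • v)
  {k : ℝ} {m : ℕ} (hk : 2 * k = m) {e₀ : H} (he : IsSmoothVector π e₀)
  (ha : annihilate π e₀ = 0) (hKm : KMinus π e₀ = 0) (hK : KZero π e₀ = (k : ℂ) • e₀)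

include hcenter hk he ha hKm hK

/-- On the derivatives of `ψ(u) = Φ(u z, u w)` the operator `z a⁺ + w K₊` acts as `d/du`, because
`a⁺` and `K₊` act on the values of `Φ` as `∂/∂z` and `∂/∂w`. -/
theorem smul_create_add_smul_KPlus_iteratedDeriv {z w : ℂ} {U : Set ℂ} (hU : IsOpen U)
    (hUw : ∀ u ∈ U, (u * z, u * w) ∈ domain) (n : ℕ) {u : ℂ} (hu : u ∈ U) :
    z • create π (iteratedDeriv n (fun u => equivariantMap π m e₀ (u * z, u * w)) u) +
        w • KPlus π (iteratedDeriv n (fun u => equivariantMap π m e₀ (u * z, u * w)) u) =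
      iteratedDeriv (n + 1) (fun u => equivariantMap π m e₀ (u * z, u * w)) u := by
  set Φ := equivariantMap π m e₀ with hΦ
  set ψ : ℂ → H := fun u => Φ (u * z, u * w) with hψ
  set D₁ : ℂ → H := fun u => fderiv ℝ Φ (u * z, u * w) (1, 0) with hD₁
  set D₂ : ℂ → H := fun u => fderiv ℝ Φ (u * z, u * w) (0, 1) with hD₂
  have hΦd {p : ℂ × ℂ} (hp : p ∈ domain) : DifferentiableAt ℂ Φ p :=
    differentiableAt_equivariantMap hcenter hk he hK ha hKm hp
  have hline (u : ℂ) : HasDerivAt (fun u : ℂ => (u * z, u * w)) (z, w) u := by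
    simpa using ((hasDerivAt_id u).mul_const z).prodMk ((hasDerivAt_id u).mul_const w)
  have hsplit {p : ℂ × ℂ} (hp : p ∈ domain) (x y : ℂ) :
      fderiv ℝ Φ p (x, y) = x • fderiv ℝ Φ p (1, 0) + y • fderiv ℝ Φ p (0, 1) := by
    rw [← (hΦd hp).fderiv_real_smul, ← (hΦd hp).fderiv_real_smul, ← map_add]
    simp
  have hψ' : ∀ u ∈ U, HasDerivAt ψ (z • D₁ u + w • D₂ u) u := by
    intro u hu
    have h := (hΦd (hUw u hu)).hasFDerivAt.comp_hasDerivAt u (hline u)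
    refine h.congr_deriv ?_
    rw [hD₁, hD₂, ← hsplit (hUw u hu), (hΦd (hUw u hu)).fderiv_restrictScalars ℝ]
    rfl
  have hψd : DifferentiableOn ℂ ψ U := fun u hu =>
    (hψ' u hu).differentiableAt.differentiableWithinAt
  have hDd (v : ℂ × ℂ) : DifferentiableOn ℂ (fun u : ℂ => fderiv ℝ Φ (u * z, u * w) v) U := by
    intro u hu
    have h := differentiableAt_complex_fderiv_apply
      ((contDiffAt_equivariantMap he m (hUw u hu)).of_le (WithTop.coe_le_coe.2 le_top))
      (Filter.eventually_of_mem (isOpen_domain.mem_nhds (hUw u hu)) fun q hq => hΦd hq) v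
    exact (h.comp u (hline u).differentiableAt).differentiableWithinAt
  have hD₁d : DifferentiableOn ℂ D₁ U := hDd (1, 0)
  have hD₂d : DifferentiableOn ℂ D₂ U := hDd (0, 1)
  have hcreate : create π (iteratedDeriv n ψ u) = iteratedDeriv n D₁ u := by
    refine create_eq_of_mem_generatorGraph
      (B := iteratedDeriv n (fun u => (-(u * z)) • ψ u + (-(u * w)) • D₁ u) u) fun α => ?_
    refine iteratedDeriv_mem_generatorGraph (heisenberg_add α) hU hψd hD₁d (by fun_prop) α ?_ n u hu
    intro u hu
    have h := hasDerivAt_heisenberg_equivariantMap hcenter hk he hK α (hUw u hu)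
    refine h.congr_deriv ?_
    rw [hsplit (hUw u hu)]
    module
  have hKPlus : KPlus π (iteratedDeriv n ψ u) = iteratedDeriv n D₂ u := by
    refine KPlus_eq_of_mem_generatorGraph (B := iteratedDeriv n (fun u =>
      (-(m * (u * w) + (u * z) ^ 2 / 2)) • ψ u + (-((u * w) * (u * z))) • D₁ u +
        (-(u * w) ^ 2) • D₂ u) u) fun β hβ => ?_
    refine iteratedDeriv_mem_generatorGraph (boost_add β hβ) hU hψd hD₂d (by fun_prop) β ?_ n u hu
    intro u hu
    have h := hasDerivAt_boost_equivariantMap hcenter hk he hK β hβ (hUw u hu)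
    refine h.congr_deriv ?_
    rw [hsplit (hUw u hu)]
    module
  rw [hcreate, hKPlus]
  clear hcreate hKPlus
  induction n generalizing u with
  | zero => simpa using (hψ' u hu).deriv.symm
  | succ n ih =>
    have h1 := ((hD₁d.hasDerivAt_iteratedDeriv hU n hu).const_smul z).add
      ((hD₂d.hasDerivAt_iteratedDeriv hU n hu).const_smul w)
    have h2 := hψd.hasDerivAt_iteratedDeriv hU (n + 1) hu
    exact h1.unique (h2.congr_of_eventuallyEq
      (Filter.eventually_of_mem (hU.mem_nhds hu) fun v hv => ih hv))

/-- The exponential series of the coherent state is the Taylor series at `0`, evaluated at `1`, of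
`u ↦ Φ(u z, u w)`, which is holomorphic on a disc of radius greater than `1`. -/
theorem hasSum_coherentTerm (z : ℂ) {w : ℂ} (hw : ‖w‖ < 1) :
    HasSum (coherentTerm π e₀ z w) (equivariantMap π m e₀ (z, w)) := by
  -- a radius with `1 < R` and `R ‖w‖ < 1`
  set R : ℝ := 2 / (1 + ‖w‖) with hR
  have hw0 := norm_nonneg w
  have hR1 : 1 < R := by
    rw [hR, lt_div_iff₀ (by positivity)]
    linarith
  have hRw : R * ‖w‖ < 1 := by
    rw [hR, div_mul_eq_mul_div, div_lt_one (by positivity)]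
    linarith
  have hUw : ∀ u ∈ Metric.ball (0 : ℂ) R, (u * z, u * w) ∈ domain := by
    intro u hu
    change ‖u * w‖ < 1
    rw [mem_ball_zero_iff] at hu
    rw [norm_mul]
    nlinarith
  set ψ : ℂ → H := fun u => equivariantMap π m e₀ (u * z, u * w) with hψ
  have hψd : DifferentiableOn ℂ ψ (Metric.ball 0 R) := by
    intro u hu
    have h := differentiableAt_equivariantMap hcenter hk he hK ha hKm (hUw u hu)
    exact (h.comp (f := fun u : ℂ => (u * z, u * w)) u (by fun_prop)).differentiableWithinAt
  have h0 : (0 : ℂ) ∈ Metric.ball (0 : ℂ) R := Metric.mem_ball_self (by linarith)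
  have hiter (n : ℕ) :
      (fun v : H => z • create π v + w • KPlus π v)^[n] e₀ = iteratedDeriv n ψ 0 := by
    induction n with
    | zero =>
      have := equivariantMap_zero hcenter hk he hK
      simp only [iteratedDeriv_zero, hψ, zero_mul, Function.iterate_zero_apply]
      exact this.symm
    | succ n ih =>
      rw [Function.iterate_succ_apply', ih]
      exact smul_create_add_smul_KPlus_iteratedDeriv hcenter hk he ha hKm hK Metric.isOpen_ball
        hUw n h0
  have h := Complex.hasSum_taylorSeries_on_ball hψd (z := 1) (by simpa using hR1)
  simp only [sub_zero, one_pow, one_smul, ← hiter] at h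
  simp only [hψ, one_mul] at h
  exact h

theorem coherentState_eq_equivariantMap (z : ℂ) {w : ℂ} (hw : ‖w‖ < 1) :
    coherentState π e₀ z w = equivariantMap π m e₀ (z, w) :=
  (hasSum_coherentTerm hcenter hk he ha hKm hK z hw).tsum_eq

end CoherentStates

end JacobiRep

theorem mainTheorem3 {H : Type*} [NormedAddCommGroup H] [InnerProductSpace ℂ H] [CompleteSpace H]
    (π : JacobiGroup →* (H ≃ₗᵢ[ℂ] H))
    (hcont : ∀ v : H, Continuous fun h : JacobiGroup => π h v)
    (hcenter : ∀ (t : ℝ) (v : H), π ⟨1, 0, t⟩ v = Complex.exp (Complex.I * (t : ℂ)) • v)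
    (k : ℝ) (m : ℕ) (hm : 2 ≤ m) (hk : 2 * k = m)
    (e₀ : H) (hsmooth : JacobiRep.IsSmoothVector π e₀)
    (ha : JacobiRep.annihilate π e₀ = 0)
    (hKminus : JacobiRep.KMinus π e₀ = 0)
    (hKzero : JacobiRep.KZero π e₀ = (k : ℂ) • e₀) :
    -- the coherent state vectors are well defined
    (∀ z w : ℂ, ‖w‖ < 1 → Summable (JacobiRep.coherentTerm π e₀ z w)) ∧
    -- the action of the Jacobi group on coherent state vectors
    (∀ (g : SU11) (α z w : ℂ), ‖w‖ < 1 →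
      conj g.b * w + conj g.a ≠ 0 ∧
      ‖(g.a * w + g.b) / (conj g.b * w + conj g.a)‖ < 1 ∧
      JacobiRep.S π g (JacobiRep.D π α (JacobiRep.coherentState π e₀ z w)) =
        JacobiGroup.factor m g α z w •
          JacobiRep.coherentState π e₀
            ((α - conj α * w + z) / (conj g.b * w + conj g.a))
            ((g.a * w + g.b) / (conj g.b * w + conj g.a))) ∧
    -- the formulas for `(z₁, w₁)` are an action of the Jacobi group by holomorphic maps
    (∀ h : JacobiGroup, Set.MapsTo h.act JacobiGroup.domain JacobiGroup.domain ∧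
      DifferentiableOn ℂ h.act JacobiGroup.domain) ∧
    (∀ p ∈ JacobiGroup.domain, (1 : JacobiGroup).act p = p) ∧
    (∀ h₁ h₂ : JacobiGroup, ∀ p ∈ JacobiGroup.domain, (h₁ * h₂).act p = h₁.act (h₂.act p)) ∧
    -- the factor is a holomorphic multiplier of this action
    (∀ h : JacobiGroup, DifferentiableOn ℂ (h.multiplier m) JacobiGroup.domain ∧
      ∀ p ∈ JacobiGroup.domain, h.multiplier m p ≠ 0) ∧
    (∀ h₁ h₂ : JacobiGroup, ∀ p ∈ JacobiGroup.domain,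
      (h₁ * h₂).multiplier m p = h₁.multiplier m (h₂.act p) * h₂.multiplier m p) := by
  refine ⟨fun z w hw => (JacobiRep.hasSum_coherentTerm hcenter hk hsmooth ha hKminus hKzero z
      hw).summable, fun g α z w hw => ⟨g.denom_ne_zero hw, g.norm_mobius_lt_one hw, ?_⟩,
    fun h => ⟨fun p hp => h.act_mem_domain hp,
      fun p hp => (h.differentiableAt_act hp).differentiableWithinAt⟩,
    fun p _ => JacobiGroup.one_act p, fun h₁ h₂ p hp => JacobiGroup.mul_act h₁ h₂ hp,
    fun h => ⟨fun p hp => (h.differentiableAt_multiplier m hp).differentiableWithinAt,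
      fun p hp => h.multiplier_ne_zero m hp⟩,
    fun h₁ h₂ p hp => JacobiGroup.multiplier_mul m h₁ h₂ hp⟩
  have hmul : (⟨g, 0, 0⟩ : JacobiGroup) * JacobiGroup.heisenberg α 1 = ⟨g, α, 0⟩ := by
    ext1 <;> simp [JacobiGroup.heisenberg, SU11.planeAct]
  have key := JacobiRep.apply_equivariantMap hcenter hk hsmooth hKzero ⟨g, α, 0⟩ (p := (z, w)) hw
  rw [JacobiRep.S, JacobiRep.D, ← JacobiRep.map_mul_apply, hmul,
    JacobiRep.coherentState_eq_equivariantMap hcenter hk hsmooth ha hKminus hKzero z hw,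
    JacobiRep.coherentState_eq_equivariantMap hcenter hk hsmooth ha hKminus hKzero _
      (g.norm_mobius_lt_one hw), key]
  simp [JacobiGroup.multiplier, JacobiGroup.act]
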